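/- **Definitions.** Let $n\in\mathbb N$ and $[n]=\{1,\dots,n\}$. For $\varepsilon>0$ and $\delta\in[0,1]$, two probability distributions $P,Q$ on the same measurable space are $(\varepsilon,\delta)$-*indistinguishable* if $P(S)\le e^{\varepsilon}Q(S)+\delta$ and $Q(S)\le e^{\varepsilon}P(S)+\delta$ for every event $S$. Two graphs on node set $[n]$ are *node neighbors* if they differ only in the set of edges incident to a single node. A randomized algorithm $\mathcal A$ that takes graphs $G$ on node set $[n]$ as input is (noninteractive) $(\varepsilon,\delta)$-*local node differentially private* ($(\varepsilon,\delta)$-LNDP) if there are a distribution $\mathcal D$ of public randomness $\rho$, local randomizers $\mathcal R_{1,\rho},\dots,\mathcal R_{n,\rho}$ using independent private coins, and a (possibly randomized) postprocessing algorithm $\mathcal P$ such that 1. for every graph $G$ on $[n]$, $\mathcal A(G)$ has the distribution of $\mathcal P\bigl(\mathcal R_{1,\rho}(N_1^G),\dots,\mathcal R_{n,\rho}(N_n^G)\bigr)$ with $\rho\sim\mathcal D$, where $N_i^G$ is the set of neighbors of node $i$ in $G$; and 2. for every fixed $\rho$ and all node-neighboring graphs $G,G'$ on $[n]$, the joint distributions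 of $\bigl(\mathcal R_{1,\rho}(N_1^{G}),\dots,\mathcal R_{n,\rho}(N_n^{G})\bigr)$ and $\bigl(\mathcal R_{1,\rho}(N_1^{G'}),\dots,\mathcal R_{n,\rho}(N_n^{G'})\bigr)$ are $(\varepsilon,\delta)$-indistinguishable. $G(n,p)$ denotes the Erdős–Rényi random graph on $[n]$ in which each of the $\binom n2$ possible edges is present independently with probability $p$. **Theorem (error for private Erdős–Rényi parameter estimation).** There exist absolute constants $c>0$ and $C>0$ and an $N\in\mathbb N$ such that for all $n\ge N$, all $\varepsilon\in(0,c]$, all $\delta\in\bigl[0,\frac{c\,\varepsilon}{n\log n}\bigr]$, every $(\varepsilon,\delta)$-LNDP algorithm $\mathcal A$ on $n$-node graphs with real-valued output, and every $\alpha\in\mathbb R$, the following holds. If $$\Pr_{G\sim G(n,p);\ \text{coins of }\mathcal A}\bigl[\,|\mathcal A(G)-p|\le\alpha\,\bigr]\ \ge\ \tfrac23\qquad\text{for every }p\in[0,1],$$ then $$\alpha\ \ge\ C\cdot\min\Bigl\{\frac1{n\varepsilon},\,1\Bigr\}.$$ -/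

import Mathlib

open MeasureTheory ProbabilityTheory

universe u v

namespace LNDP

/-- The probability measures `μ` and `ν` are `(ε, δ)`-indistinguishable if
`μ S ≤ exp ε * ν S + δ` and `ν S ≤ exp ε * μ S + δ` for every event `S`. -/
def Indistinguishable {Y : Type*} [MeasurableSpace Y] (ε δ : ℝ) (μ ν : Measure Y) : Prop :=
  ∀ S : Set Y, MeasurableSet S →
    μ S ≤ ENNReal.ofReal (Real.exp ε) * ν S + ENNReal.ofReal δ ∧
      ν S ≤ ENNReal.ofReal (Real.exp ε) * μ S + ENNReal.ofReal δ

/-- Two graphs on the same node set are node neighbors if they differ only in the set of edges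
incident to some single node `i`. -/
def NodeNeighbors {V : Type*} (G H : SimpleGraph V) : Prop :=
  ∃ i : V, ∀ j k : V, j ≠ i → k ≠ i → (G.Adj j k ↔ H.Adj j k)

/-- A noninteractive local protocol on `n` nodes with final output in `Z`: a distribution `pub` of
the public randomness, for every node `i` a local randomizer `rand i` which turns the
neighborhood of `i` and the public randomness into a random report in `Out i`, and a (randomized)
postprocessing algorithm `post` run on the vector of reports. -/
structure Protocol (n : ℕ) (Z : Type*) [MeasurableSpace Z] where
  Pub : Type u
  [measPub : MeasurableSpace Pub]
  pub : Measure Pub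
  [probPub : IsProbabilityMeasure pub]
  Out : Fin n → Type v
  [measOut : ∀ i, MeasurableSpace (Out i)]
  rand : ∀ i, Set (Fin n) → Kernel Pub (Out i)
  [markovRand : ∀ i N, IsMarkovKernel (rand i N)]
  post : Kernel (∀ i, Out i) Z
  [markovPost : IsMarkovKernel post]

attribute [instance] Protocol.measPub Protocol.probPub Protocol.measOut Protocol.markovRand
  Protocol.markovPost

namespace Protocol

variable {n : ℕ} {Z : Type*} [MeasurableSpace Z]

/-- The joint law of the reports of all nodes on input `G`, for fixed public randomness `r`: the
nodes use independent private randomness, and node `i` only sees its own neighborhood. -/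
noncomputable def reports (P : Protocol.{u, v} n Z) (r : P.Pub) (G : SimpleGraph (Fin n)) :
    Measure (∀ i, P.Out i) :=
  Measure.pi fun i => P.rand i (G.neighborSet i) r

/-- The law of the final output on input `G`: sample the public randomness, then the reports, and
postprocess the reports. -/
noncomputable def outputLaw (P : Protocol.{u, v} n Z) (G : SimpleGraph (Fin n)) : Measure Z :=
  P.pub.bind fun r => (P.reports r G).bind P.post

/-- Node privacy: for every setting of the public randomness, the joint laws of the reports on
node-neighboring graphs are `(ε, δ)`-indistinguishable. -/
def IsPrivate (P : Protocol.{u, v} n Z) (ε δ : ℝ) : Prop :=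
  ∀ (r : P.Pub) (G H : SimpleGraph (Fin n)), NodeNeighbors G H →
    Indistinguishable ε δ (P.reports r G) (P.reports r H)

instance (P : Protocol.{u, v} n Z) (r : P.Pub) (G : SimpleGraph (Fin n)) :
    IsProbabilityMeasure (P.reports r G) := by
  unfold reports; infer_instance

theorem measurable_reports (P : Protocol.{u, v} n Z) (G : SimpleGraph (Fin n)) :
    Measurable fun r => P.reports r G := by
  refine Measurable.measure_of_isPiSystem_of_isProbabilityMeasure generateFrom_pi.symm
    isPiSystem_pi ?_
  rintro _ ⟨s, hs, rfl⟩
  simp only [reports, Measure.pi_pi]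
  exact Finset.measurable_prod _ fun i _ =>
    (P.rand i (G.neighborSet i)).measurable_coe (hs i (Set.mem_univ i))

/-- The output law is a probability measure. -/
instance isProbabilityMeasure_outputLaw (P : Protocol.{u, v} n Z) (G : SimpleGraph (Fin n)) :
    IsProbabilityMeasure (P.outputLaw G) := by
  have h : Measurable fun r => (P.reports r G).bind P.post :=
    (Measure.measurable_bind' P.post.measurable).comp (P.measurable_reports G)
  refine ⟨?_⟩
  rw [outputLaw, Measure.bind_apply MeasurableSet.univ h.aemeasurable]
  simp [Measure.bind_apply MeasurableSet.univ P.post.measurable.aemeasurable]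

end Protocol

/-- A randomized algorithm `A` on `n`-node graphs, given by its output law on each graph, is
(noninteractive) `(ε, δ)`-local node differentially private. -/
def IsLNDP {n : ℕ} {Z : Type*} [MeasurableSpace Z] (ε δ : ℝ)
    (A : SimpleGraph (Fin n) → Measure Z) : Prop :=
  ∃ P : Protocol.{u, v} n Z, (∀ G, A G = P.outputLaw G) ∧ P.IsPrivate ε δ

/-- The probability, over `G ∼ G(n, p)` and the coins of `A`, that `A G` estimates `p` with
additive error at most `α`. -/
noncomputable def successProb {n : ℕ} (A : SimpleGraph (Fin n) → Measure ℝ)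
    (p : unitInterval) (α : ℝ) : ENNReal :=
  ∫⁻ G, A G {x : ℝ | |x - p| ≤ α} ∂(SimpleGraph.binomialRandom (Fin n) p)

end LNDP

/-! The success probability of a private protocol on `G(n, t)` is Lipschitz in `t` with constant
O(εn + δn²), so two parameters at distance of order min(1/(nε), 1) cannot be told apart.

The derivative in `t` of the probability of an output event is the correlation of that event with
the score of `G(n, t)`, a sum over pairs of the centred edge scores s_ij. Fix the public randomness
and let g be the probability of the event given the reports. If the randomizers of i and j are both
fed the empty neighborhood, the law of the reports no longer depends on the edge ij, so s_ij is
uncorrelated with the mean of g. Privacy provides near densities l_i, within O(ε) of 1, for passing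
from the true report of i to the empty-neighborhood one. Up to O(δ) per pair, the derivative is thus
the mean of g·X with X = ∑ s_ij (1 - l_i l_j), a sum over pairs.

A termwise bound on X would give εn². But given `G` the variables w_i = l_i - 1 are independent and
centred, and -X is ∑_j w_j T_j plus the sum of s_ij w_i w_j over pairs, with T_j the score of the
star at j, of typical size √n. Orthogonality, of the w's given `G` and of the edge scores over `G`,
makes X of order εn in mean square (`integral_sq_sum_pairs_le`,
`sum_graphWeight_mul_sq_sum_edgeScore_le`). These combine in `abs_sum_graphWeight_mul_score_le`. -/

namespace LNDP

/-! ### Near densities from approximate indistinguishability -/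

section Density

variable {Y : Type*} [MeasurableSpace Y]

theorem Indistinguishable.real_le {ε δ : ℝ} {μ ν : Measure Y} [IsProbabilityMeasure μ]
    [IsProbabilityMeasure ν] (hδ : 0 ≤ δ) (h : Indistinguishable ε δ μ ν) {S : Set Y}
    (hS : MeasurableSet S) :
    μ.real S ≤ Real.exp ε * ν.real S + δ ∧ ν.real S ≤ Real.exp ε * μ.real S + δ := by
  have key : ∀ a b : ENNReal, a ≠ ⊤ → b ≠ ⊤ →
      a ≤ ENNReal.ofReal (Real.exp ε) * b + ENNReal.ofReal δ →
      a.toReal ≤ Real.exp ε * b.toReal + δ := by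
    intro a b ha hb hab
    have h1 := ENNReal.toReal_mono (by finiteness) hab
    rwa [ENNReal.toReal_add (by finiteness) (by finiteness), ENNReal.toReal_mul,
      ENNReal.toReal_ofReal (Real.exp_pos _).le, ENNReal.toReal_ofReal hδ] at h1
  exact ⟨key _ _ (measure_ne_top _ _) (measure_ne_top _ _) (h S hS).1,
    key _ _ (measure_ne_top _ _) (measure_ne_top _ _) (h S hS).2⟩

/-- The Radon-Nikodym derivative truncated to `[a, b]` is almost a density, if `ν` is almost
between `a • μ` and `b • μ`. -/
theorem abs_integral_mul_clip_sub_le {μ ν : Measure Y} [IsProbabilityMeasure μ]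
    [IsProbabilityMeasure ν] {a b δ : ℝ} (ha : 0 ≤ a) (hab : a ≤ b)
    (h1 : ∀ S, MeasurableSet S → a * μ.real S ≤ ν.real S + δ)
    (h2 : ∀ S, MeasurableSet S → ν.real S ≤ b * μ.real S + δ)
    {g : Y → ℝ} (hg : Measurable g) (hg0 : ∀ y, 0 ≤ g y) (hg1 : ∀ y, g y ≤ 1) :
    |∫ y, g y * max a (min (ν.rnDeriv μ y).toReal b) ∂μ - ∫ y, g y ∂ν| ≤ δ := by
  set f : Y → ℝ := fun y => (ν.rnDeriv μ y).toReal with hf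
  have hfm : Measurable f := (Measure.measurable_rnDeriv ν μ).ennreal_toReal
  have hfi : Integrable f μ := Measure.integrable_toReal_rnDeriv
  obtain ⟨N, hN, hsN, hμN⟩ := Measure.mutuallySingular_singularPart ν μ
  have hdec : ν = ν.singularPart μ + μ.withDensity (ν.rnDeriv μ) :=
    (Measure.haveLebesgueDecomposition_add ν μ)
  have hreal : ∀ S, MeasurableSet S → ν.real S = (ν.singularPart μ).real S + ∫ y in S, f y ∂μ := by
    intro S hS
    conv_lhs => rw [hdec]
    rw [measureReal_add_apply, Measure.setIntegral_toReal_rnDeriv_eq_withDensity]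
  have hint : ∫ y, g y ∂ν = ∫ y, g y ∂(ν.singularPart μ) + ∫ y, g y * f y ∂μ := by
    have hgb : ∀ y, ‖g y‖ ≤ 1 := fun y => by rw [Real.norm_of_nonneg (hg0 y)]; exact hg1 y
    conv_lhs => rw [hdec]
    rw [integral_add_measure (Integrable.of_bound hg.aestronglyMeasurable 1 (.of_forall hgb))]
    · congr 1
      rw [integral_withDensity_eq_integral_toReal_smul (Measure.measurable_rnDeriv ν μ)
        (Measure.rnDeriv_lt_top ν μ)]
      simp [hf, mul_comm]
    · have : IsFiniteMeasure (μ.withDensity (ν.rnDeriv μ)) := by infer_instance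
      exact Integrable.of_bound hg.aestronglyMeasurable 1 (.of_forall hgb)
  have hbd : ∀ y, |max a (min (f y) b)| ≤ b := fun y => by
    rw [abs_of_nonneg (ha.trans (le_max_left _ _))]
    exact max_le hab (min_le_right _ _)
  have hgfi : Integrable (fun y => g y * f y) μ :=
    hfi.bdd_mul (c := 1) hg.aestronglyMeasurable
      (.of_forall fun y => by rw [Real.norm_of_nonneg (hg0 y)]; exact hg1 y)
  have hgφi : Integrable (fun y => g y * max a (min (f y) b)) μ := by
    refine Integrable.of_bound (by fun_prop) (1 * b) (.of_forall fun y => ?_)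
    rw [norm_mul, Real.norm_of_nonneg (hg0 y)]
    exact mul_le_mul (hg1 y) (hbd y) (abs_nonneg _) zero_le_one
  have hNae : ∀ᵐ y ∂μ, y ∈ N := by
    rw [ae_iff]; exact hμN
  have hsing0 : ∀ S, S ⊆ N → (ν.singularPart μ).real S = 0 := fun S hS => by
    rw [measureReal_def, measure_mono_null hS hsN, ENNReal.toReal_zero]
  have hga : 0 ≤ ∫ y, g y ∂(ν.singularPart μ) := integral_nonneg hg0
  have hgb : ∫ y, g y ∂(ν.singularPart μ) ≤ (ν.singularPart μ).real Set.univ := by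
    refine (Real.le_norm_self _).trans ((norm_integral_le_of_norm_le_const (C := 1)
      (.of_forall fun y => ?_)).trans_eq (one_mul _))
    rw [Real.norm_of_nonneg (hg0 y)]; exact hg1 y
  rw [hint, abs_sub_le_iff]
  constructor
  -- Truncation raises `f` only where `f < a`, and the total raise there is at most aμ(S) - ν(S).
  -- Intersecting with `N`, which carries `μ`, discards the singular part of `ν`.
  · set S : Set Y := {y | f y < a} ∩ N
    have hS : MeasurableSet S := (measurableSet_lt hfm measurable_const).inter hN
    have h3 : ∫ y, g y * max a (min (f y) b) ∂μ - ∫ y, g y * f y ∂μ ≤ ∫ y in S, (a - f y) ∂μ := by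
      rw [← integral_sub hgφi hgfi, ← integral_indicator hS]
      refine integral_mono_ae (hgφi.sub hgfi)
        (((integrable_const a).sub hfi).indicator hS) ?_
      filter_upwards [hNae] with y hy
      rw [← mul_sub]
      by_cases hya : f y < a
      · rw [Set.indicator_of_mem (show y ∈ S from ⟨hya, hy⟩), min_eq_left (hya.le.trans hab),
          max_eq_left hya.le]
        exact mul_le_of_le_one_left (sub_nonneg.2 hya.le) (hg1 y)
      · rw [Set.indicator_of_notMem (fun h => hya h.1)]
        refine mul_nonpos_of_nonneg_of_nonpos (hg0 y) (sub_nonpos.2 (max_le (not_lt.1 hya) ?_))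
        exact min_le_left _ _
    rw [integral_sub (integrable_const a).integrableOn hfi.integrableOn, setIntegral_const] at h3
    have h4 := hreal S hS
    rw [hsing0 S Set.inter_subset_right] at h4
    have h5 := h1 S hS
    simp only [smul_eq_mul] at h3
    linarith
  -- Adjoining the `μ`-null set `Nᶜ` lets a single use of `h2` pay both for the density above `b`
  -- and for the singular mass.
  · set S : Set Y := {y | b < f y} ∪ Nᶜ
    have hS : MeasurableSet S := (measurableSet_lt measurable_const hfm).union hN.compl
    have h3 : ∫ y, g y * f y ∂μ - ∫ y, g y * max a (min (f y) b) ∂μ ≤ ∫ y in S, (f y - b) ∂μ := by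
      rw [← integral_sub hgfi hgφi, ← integral_indicator hS]
      refine integral_mono_ae (hgfi.sub hgφi)
        ((hfi.sub (integrable_const b)).indicator hS) ?_
      filter_upwards [hNae] with y hy
      rw [← mul_sub]
      by_cases hyb : b < f y
      · rw [Set.indicator_of_mem (show y ∈ S from Or.inl hyb), min_eq_right hyb.le,
          max_eq_right hab]
        exact mul_le_of_le_one_left (sub_nonneg.2 hyb.le) (hg1 y)
      · rw [Set.indicator_of_notMem (fun h => h.elim hyb fun h => h hy),
          min_eq_left (not_lt.1 hyb)]
        exact mul_nonpos_of_nonneg_of_nonpos (hg0 y) (sub_nonpos.2 (le_max_right _ _))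
    rw [integral_sub hfi.integrableOn (integrable_const b).integrableOn, setIntegral_const] at h3
    have h4 := hreal S hS
    have h5 := h2 S hS
    have h6 : (ν.singularPart μ).real Set.univ ≤ (ν.singularPart μ).real S := by
      have := measureReal_union_le (μ := ν.singularPart μ) N Nᶜ
      rw [Set.union_compl_self, hsing0 N subset_rfl, zero_add] at this
      exact this.trans (measureReal_mono Set.subset_union_right)
    simp only [smul_eq_mul] at h3
    linarith

/-- Truncating the derivative to [e^{-ε}, e^ε] costs δ on every test function, in particular on the
constant 1. Dividing by the total mass then costs another δ and widens the range to e^{±2ε}. The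
exact normalization is what makes `l - 1` exactly centred, as orthogonality requires. -/
theorem Indistinguishable.exists_density {ε δ : ℝ} {μ ν : Measure Y} [IsProbabilityMeasure μ]
    [IsProbabilityMeasure ν] (hε : 0 ≤ ε) (hδ : 0 ≤ δ) (h : Indistinguishable ε δ μ ν) :
    ∃ l : Y → ℝ, Measurable l ∧ (∀ y, Real.exp (-(2 * ε)) ≤ l y ∧ l y ≤ Real.exp (2 * ε)) ∧
      ∫ y, l y ∂μ = 1 ∧
      ∀ g : Y → ℝ, Measurable g → (∀ y, 0 ≤ g y) → (∀ y, g y ≤ 1) →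
        |∫ y, g y * l y ∂μ - ∫ y, g y ∂ν| ≤ 2 * δ := by
  set φ : Y → ℝ := fun y => max (Real.exp (-ε)) (min (ν.rnDeriv μ y).toReal (Real.exp ε)) with hφ
  have hφm : Measurable φ := by
    have := (Measure.measurable_rnDeriv ν μ).ennreal_toReal
    fun_prop
  have hee : Real.exp (-ε) ≤ Real.exp ε := Real.exp_le_exp.2 (by linarith)
  have hφa : ∀ y, Real.exp (-ε) ≤ φ y := fun y => le_max_left _ _
  have hφb : ∀ y, φ y ≤ Real.exp ε := fun y => max_le hee (min_le_right _ _)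
  have hclip : ∀ g : Y → ℝ, Measurable g → (∀ y, 0 ≤ g y) → (∀ y, g y ≤ 1) →
      |∫ y, g y * φ y ∂μ - ∫ y, g y ∂ν| ≤ δ := fun g hg hg0 hg1 => by
    refine abs_integral_mul_clip_sub_le (Real.exp_pos _).le hee (fun S hS => ?_)
      (fun S hS => (h.real_le hδ hS).2) hg hg0 hg1
    have h1 := mul_le_mul_of_nonneg_left (h.real_le hδ hS).1 (Real.exp_pos (-ε)).le
    rw [mul_add, ← mul_assoc, ← Real.exp_add, neg_add_cancel, Real.exp_zero, one_mul] at h1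
    have h2 : Real.exp (-ε) * δ ≤ δ :=
      mul_le_of_le_one_left hδ (Real.exp_le_one_iff.2 (by linarith))
    linarith
  have hφi : ∀ g : Y → ℝ, Measurable g → (∀ y, 0 ≤ g y) → (∀ y, g y ≤ 1) →
      Integrable (fun y => g y * φ y) μ := fun g hg hg0 hg1 => by
    refine Integrable.of_bound (by fun_prop) (1 * Real.exp ε) (.of_forall fun y => ?_)
    rw [norm_mul, Real.norm_of_nonneg (hg0 y),
      Real.norm_of_nonneg ((Real.exp_pos _).le.trans (hφa y))]
    exact mul_le_mul (hg1 y) (hφb y) ((Real.exp_pos _).le.trans (hφa y)) zero_le_one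
  have hφ1 : Integrable φ μ := by
    simpa using hφi (fun _ => 1) measurable_const (fun _ => zero_le_one) (fun _ => le_rfl)
  set c : ℝ := ∫ y, φ y ∂μ with hc
  have hca : Real.exp (-ε) ≤ c := by
    have := integral_mono (integrable_const (Real.exp (-ε))) hφ1 hφa
    simpa using this
  have hcb : c ≤ Real.exp ε := by
    have := integral_mono hφ1 (integrable_const (Real.exp ε)) hφb
    simpa using this
  have hc0 : 0 < c := (Real.exp_pos _).trans_le hca
  have hc1 : |c - 1| ≤ δ := by
    simpa using hclip (fun _ => 1) measurable_const (fun _ => zero_le_one) (fun _ => le_rfl)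
  refine ⟨fun y => φ y / c, hφm.div_const c, fun y => ⟨?_, ?_⟩, ?_, fun g hg hg0 hg1 => ?_⟩
  · rw [le_div_iff₀ hc0]
    refine (mul_le_mul_of_nonneg_left hcb (Real.exp_pos _).le).trans ?_
    rw [← Real.exp_add, show -(2 * ε) + ε = -ε by ring]
    exact hφa y
  · rw [div_le_iff₀ hc0]
    refine le_trans ?_ (mul_le_mul_of_nonneg_left hca (Real.exp_pos _).le)
    rw [← Real.exp_add, show 2 * ε + -ε = ε by ring]
    exact hφb y
  · rw [integral_div, div_self hc0.ne']
  · have h1 := hclip g hg hg0 hg1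
    set d : ℝ := ∫ y, g y * φ y ∂μ with hd
    have hd0 : 0 ≤ d := integral_nonneg fun y =>
      mul_nonneg (hg0 y) ((Real.exp_pos _).le.trans (hφa y))
    have hdc : d ≤ c := integral_mono (hφi g hg hg0 hg1) hφ1 fun y =>
      mul_le_of_le_one_left ((Real.exp_pos _).le.trans (hφa y)) (hg1 y)
    have h2 : ∫ y, g y * (φ y / c) ∂μ = d / c := by
      rw [hd, ← integral_div]; simp only [mul_div_assoc]
    have h3 : |d / c - d| ≤ δ := by
      have : d / c - d = (d / c) * (1 - c) := by field_simp
      rw [this, abs_mul, abs_sub_comm, abs_of_nonneg (div_nonneg hd0 hc0.le)]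
      exact (mul_le_of_le_one_left (abs_nonneg _) ((div_le_one hc0).2 hdc)).trans hc1
    rw [h2]
    have := abs_sub_le (d / c) d (∫ y, g y ∂ν)
    linarith

end Density

/-! ### Changing one factor of a product measure -/

section Resample

variable {ι : Type*} [Fintype ι] [DecidableEq ι] {Ω : ι → Type*} [∀ i, MeasurableSpace (Ω i)]

instance isProbabilityMeasure_update (P : ∀ i, Measure (Ω i)) [∀ i, IsProbabilityMeasure (P i)]
    (i : ι) (Q : Measure (Ω i)) [IsProbabilityMeasure Q] (j : ι) :
    IsProbabilityMeasure (Function.update P i Q j) := by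
  by_cases h : j = i
  · subst h; simpa
  · rw [Function.update_of_ne h]; infer_instance

/-- Changing the `i`-th factor of a product measure amounts to resampling the `i`-th coordinate. -/
theorem pi_update_eq_map (P : ∀ i, Measure (Ω i)) [∀ i, IsProbabilityMeasure (P i)]
    (i : ι) (Q : Measure (Ω i)) [IsProbabilityMeasure Q] :
    Measure.pi (Function.update P i Q) =
      ((Measure.pi P).prod Q).map (fun p => Function.update p.1 i p.2) := by
  have hm : Measurable (fun p : (∀ j, Ω j) × Ω i => Function.update p.1 i p.2) := by
    fun_prop
  refine Measure.pi_eq fun s hs => ?_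
  rw [Measure.map_apply hm (MeasurableSet.univ_pi hs)]
  have : (fun p : (∀ j, Ω j) × Ω i => Function.update p.1 i p.2) ⁻¹' Set.univ.pi s =
      (Set.univ.pi (Function.update s i Set.univ)) ×ˢ (s i) := by
    ext ⟨y, z⟩
    simp only [Set.mem_preimage, Set.mem_pi, Set.mem_univ, true_implies, Set.mem_prod]
    constructor
    · intro h
      refine ⟨fun j => ?_, by simpa using h i⟩
      by_cases hj : j = i
      · subst hj; simp
      · simpa [hj] using h j
    · rintro ⟨h, hz⟩ j
      by_cases hj : j = i
      · subst hj; simpa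
      · simpa [hj] using h j
  rw [this, Measure.prod_prod, Measure.pi_pi, ← Finset.mul_prod_erase _ _ (Finset.mem_univ i),
    ← Finset.mul_prod_erase (a := i) _ _ (Finset.mem_univ i)]
  simp only [Function.update_self, measure_univ, one_mul]
  rw [mul_comm]
  congr 1
  refine Finset.prod_congr rfl fun j hj => ?_
  rw [Function.update_of_ne (Finset.ne_of_mem_erase hj),
    Function.update_of_ne (Finset.ne_of_mem_erase hj)]

theorem integral_pi_update (P : ∀ i, Measure (Ω i)) [∀ i, IsProbabilityMeasure (P i)]
    (i : ι) (Q : Measure (Ω i)) [IsProbabilityMeasure Q] {f : (∀ j, Ω j) → ℝ} {B : ℝ}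
    (hf : Measurable f) (hB : ∀ y, |f y| ≤ B) :
    ∫ y, f y ∂(Measure.pi (Function.update P i Q)) =
      ∫ y, ∫ z, f (Function.update y i z) ∂Q ∂(Measure.pi P) := by
  have hm : Measurable (fun p : (∀ j, Ω j) × Ω i => Function.update p.1 i p.2) := by
    fun_prop
  rw [pi_update_eq_map, integral_map hm.aemeasurable hf.aestronglyMeasurable, integral_prod]
  exact Integrable.of_bound (hf.comp hm).aestronglyMeasurable B (.of_forall fun p => hB _)

theorem integral_pi_resample (P : ∀ i, Measure (Ω i)) [∀ i, IsProbabilityMeasure (P i)]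
    (i : ι) {f : (∀ j, Ω j) → ℝ} {B : ℝ} (hf : Measurable f) (hB : ∀ y, |f y| ≤ B) :
    ∫ y, f y ∂(Measure.pi P) = ∫ y, ∫ z, f (Function.update y i z) ∂(P i) ∂(Measure.pi P) := by
  have := integral_pi_update P i (P i) hf hB
  rwa [Function.update_eq_self] at this

theorem integral_coord_mul_eq_zero (P : ∀ i, Measure (Ω i)) [∀ i, IsProbabilityMeasure (P i)]
    (i : ι) {u : Ω i → ℝ} {F : (∀ j, Ω j) → ℝ} {κ B : ℝ} (hu : Measurable u)
    (huκ : ∀ z, |u z| ≤ κ) (hu0 : ∫ z, u z ∂(P i) = 0) (hF : Measurable F) (hFB : ∀ y, |F y| ≤ B)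
    (hFi : ∀ y z, F (Function.update y i z) = F y) :
    ∫ y, u (y i) * F y ∂(Measure.pi P) = 0 := by
  rw [integral_pi_resample P i (B := κ * B) (by fun_prop)]
  · simp [hFi, integral_mul_const, hu0]
  · intro y
    rw [abs_mul]
    exact mul_le_mul (huκ _) (hFB y) (abs_nonneg _) ((abs_nonneg _).trans (huκ (y i)))

/-- If `l` is almost a density of `Q` with respect to `P i`, then weighting by `l` almost amounts
to changing the `i`-th factor to `Q`. -/
theorem abs_integral_mul_density_sub_le (P : ∀ i, Measure (Ω i))
    [∀ i, IsProbabilityMeasure (P i)] (i : ι) (Q : Measure (Ω i)) [IsProbabilityMeasure Q]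
    {l : Ω i → ℝ} {η b B : ℝ} (hl : Measurable l) (hlb : ∀ z, |l z| ≤ b)
    (hlQ : ∀ g : Ω i → ℝ, Measurable g → (∀ y, 0 ≤ g y) → (∀ y, g y ≤ 1) →
        |∫ y, g y * l y ∂(P i) - ∫ y, g y ∂Q| ≤ η)
    {f : (∀ j, Ω j) → ℝ} (hf : Measurable f) (hf0 : ∀ y, 0 ≤ f y) (hfB : ∀ y, f y ≤ B)
    (hB : 0 < B) :
    |∫ y, f y * l (y i) ∂(Measure.pi P) - ∫ y, f y ∂(Measure.pi (Function.update P i Q))| ≤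
      B * η := by
  have hfa : ∀ y, |f y| ≤ B := fun y => by rw [abs_of_nonneg (hf0 y)]; exact hfB y
  have hm : Measurable (fun p : (∀ j, Ω j) × Ω i => Function.update p.1 i p.2) := by
    fun_prop
  have hbd : ∀ y : ∀ j, Ω j, |f y * l (y i)| ≤ B * b := fun y => by
    rw [abs_mul]; exact mul_le_mul (hfa y) (hlb _) (abs_nonneg _) hB.le
  rw [integral_pi_resample P i (B := B * b) (by fun_prop) hbd, integral_pi_update P i Q hf hfa,
    ← integral_sub]
  · rw [← Real.norm_eq_abs]
    refine (norm_integral_le_of_norm_le_const (C := B * η) (.of_forall fun y => ?_)).trans ?_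
    · rw [Real.norm_eq_abs]
      have := hlQ (fun z => f (Function.update y i z) / B)
        ((hf.comp (measurable_update y)).div_const B) (fun z => div_nonneg (hf0 _) hB.le)
        (fun z => (div_le_one hB).2 (hfB _))
      simp only [Function.update_self]
      have e1 : ∫ z, f (Function.update y i z) * l z ∂(P i) =
          B * ∫ z, f (Function.update y i z) / B * l z ∂(P i) := by
        rw [← integral_const_mul]; congr 1; ext z; field_simp
      have e2 : ∫ z, f (Function.update y i z) ∂Q =
          B * ∫ z, f (Function.update y i z) / B ∂Q := by
        rw [← integral_const_mul]; congr 1; ext z; field_simp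
      rw [e1, e2, ← mul_sub, abs_mul, abs_of_pos hB]
      exact mul_le_mul_of_nonneg_left this hB.le
    · simp
  · have : Integrable (fun p : (∀ j, Ω j) × Ω i => f (Function.update p.1 i p.2) *
        l (Function.update p.1 i p.2 i)) ((Measure.pi P).prod (P i)) :=
      Integrable.of_bound (by fun_prop) (B * b) (.of_forall fun p => hbd _)
    exact this.integral_prod_left
  · have : Integrable (fun p : (∀ j, Ω j) × Ω i => f (Function.update p.1 i p.2))
        ((Measure.pi P).prod Q) :=
      Integrable.of_bound (hf.comp hm).aestronglyMeasurable B (.of_forall fun p => hfa _)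
    exact this.integral_prod_left

end Resample

/-! ### Second moments over independent reports -/

section Orthogonality

variable {ι : Type*} [Fintype ι] [LinearOrder ι] {Ω : ι → Type*}
  [∀ i, MeasurableSpace (Ω i)]

/-- Pythagoras for martingale differences `u j (y j) * F j y`, where `F j` only depends on the
coordinates before `j`. -/
theorem integral_sq_sum_coord_mul_le (P : ∀ i, Measure (Ω i)) [∀ i, IsProbabilityMeasure (P i)]
    {u : ∀ i, Ω i → ℝ} {F : ι → (∀ j, Ω j) → ℝ} {κ B : ℝ} (hu : ∀ i, Measurable (u i))
    (huκ : ∀ i z, |u i z| ≤ κ) (hu0 : ∀ i, ∫ z, u i z ∂(P i) = 0) (hF : ∀ i, Measurable (F i))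
    (hFB : ∀ i y, |F i y| ≤ B)
    (hFi : ∀ j k, j ≤ k → ∀ y z, F j (Function.update y k z) = F j y) :
    ∫ y, (∑ j, u j (y j) * F j y) ^ 2 ∂(Measure.pi P) ≤
      κ ^ 2 * ∑ j, ∫ y, F j y ^ 2 ∂(Measure.pi P) := by
  have hb : ∀ j y, |u j (y j) * F j y| ≤ κ * B := fun j y => by
    rw [abs_mul]
    exact mul_le_mul (huκ _ _) (hFB _ _) (abs_nonneg _) ((abs_nonneg _).trans (huκ j (y j)))
  have hbb : ∀ j k y, |(u j (y j) * F j y) * (u k (y k) * F k y)| ≤ (κ * B) * (κ * B) :=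
    fun j k y => by
      rw [abs_mul]
      exact mul_le_mul (hb _ _) (hb _ _) (abs_nonneg _) ((abs_nonneg _).trans (hb j y))
  -- Coordinate `k` enters only through the centred factor `u k`, so integrating it first kills the
  -- cross term.
  have hoff : ∀ j k, j < k →
      ∫ y, (u j (y j) * F j y) * (u k (y k) * F k y) ∂(Measure.pi P) = 0 := fun j k hjk => by
    have := integral_coord_mul_eq_zero P k (F := fun y => (u j (y j) * F j y) * F k y)
      (B := (κ * B) * B) (hu k) (huκ k) (hu0 k) (by fun_prop)
      (fun y => by
        rw [abs_mul]
        exact mul_le_mul (hb _ _) (hFB _ _) (abs_nonneg _) ((abs_nonneg _).trans (hb j y)))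
      (fun y z => by
        rw [hFi j k hjk.le, hFi k k le_rfl, Function.update_of_ne hjk.ne])
    rw [← this]
    congr 1; ext y; ring
  have hdiag : ∀ j, ∫ y, (u j (y j) * F j y) * (u j (y j) * F j y) ∂(Measure.pi P) ≤
      κ ^ 2 * ∫ y, F j y ^ 2 ∂(Measure.pi P) := fun j => by
    rw [← integral_const_mul]
    refine integral_mono (Integrable.of_bound (by fun_prop) _ (.of_forall (hbb j j)))
      (Integrable.of_bound (C := κ ^ 2 * B ^ 2) (by fun_prop) (.of_forall fun y => ?_)) fun y => ?_
    · rw [Real.norm_of_nonneg (by positivity), ← sq_abs (F j y)]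
      gcongr
      exact hFB j y
    · have : u j (y j) ^ 2 ≤ κ ^ 2 := by
        rw [← sq_abs (u j (y j))]
        gcongr
        exact huκ j (y j)
      nlinarith [sq_nonneg (F j y)]
  have hexp : ∫ y, (∑ j, u j (y j) * F j y) ^ 2 ∂(Measure.pi P) =
      ∑ j, ∑ k, ∫ y, (u j (y j) * F j y) * (u k (y k) * F k y) ∂(Measure.pi P) := by
    simp only [sq, Finset.sum_mul_sum]
    have hi : ∀ j k, Integrable (fun y : ∀ i, Ω i => (u j (y j) * F j y) * (u k (y k) * F k y))
        (Measure.pi P) := fun j k => Integrable.of_bound (by fun_prop) _ (.of_forall (hbb j k))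
    rw [integral_finsetSum _ fun j _ => integrable_finsetSum _ fun k _ => hi j k]
    exact Finset.sum_congr rfl fun j _ => integral_finsetSum _ fun k _ => hi j k
  rw [hexp, Finset.mul_sum]
  refine Finset.sum_le_sum fun j _ => ?_
  rw [Finset.sum_eq_single j]
  · exact hdiag j
  · intro k _ hkj
    rcases lt_or_gt_of_ne hkj with h | h
    · rw [← hoff k j h]
      congr 1; ext y; ring
    · exact hoff j k h
  · simp

/-- For a symmetric array `s`, a sum over pairs of `s i j * (x i + x j)` is a sum over points. -/
theorem sum_pairs_symm [LocallyFiniteOrderBot ι] {s : ι → ι → ℝ} (hs : ∀ i j, s i j = s j i)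
    (hs0 : ∀ i, s i i = 0) (x : ι → ℝ) :
    ∑ j, ∑ i ∈ Finset.Iio j, s i j * (x i + x j) = ∑ j, x j * ∑ i, s i j := by
  have h1 : ∀ j, ∑ i, s i j = ∑ i with i < j, s i j + ∑ i with j < i, s i j := fun j => by
    rw [← Finset.sum_filter_add_sum_filter_not Finset.univ (fun i => i < j)]
    congr 1
    refine (Finset.sum_subset (fun i => ?_) fun i hi hi' => ?_).symm
    · simpa using fun h => le_of_lt h
    · have : i = j := by
        simp only [Finset.mem_filter, Finset.mem_univ, true_and, not_lt] at hi hi'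
        exact le_antisymm hi' hi
      rw [this, hs0]
  have h2 : ∀ j : ι, Finset.Iio j = Finset.univ.filter (fun i => i < j) := fun j => by ext; simp
  simp only [h1, h2, mul_add, Finset.sum_add_distrib, Finset.mul_sum]
  rw [add_comm]
  congr 1
  · exact Finset.sum_congr rfl fun j _ => Finset.sum_congr rfl fun i _ => mul_comm _ _
  · rw [Finset.sum_comm' (t' := Finset.univ) (s' := fun i => Finset.univ.filter (fun j => i < j))
      (by simp)]
    exact Finset.sum_congr rfl fun j _ => Finset.sum_congr rfl fun i _ => by rw [hs, mul_comm]

/-- Second moment of the total effect of reweighting pairs of coordinates. -/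
theorem integral_sq_sum_pairs_le [LocallyFiniteOrderBot ι] (P : ∀ i, Measure (Ω i))
    [∀ i, IsProbabilityMeasure (P i)] {l : ∀ i, Ω i → ℝ} {κ : ℝ} (hl : ∀ i, Measurable (l i))
    (hlκ : ∀ i z, |l i z - 1| ≤ κ) (hl1 : ∀ i, ∫ z, l i z ∂(P i) = 1)
    {s : ι → ι → ℝ} (hs : ∀ i j, s i j = s j i) (hs0 : ∀ i, s i i = 0) :
    ∫ y, (∑ j, ∑ i ∈ Finset.Iio j, s i j * (1 - l i (y i) * l j (y j))) ^ 2 ∂(Measure.pi P) ≤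
      κ ^ 2 * ∑ j, (2 * (∑ i, s i j) ^ 2 + 2 * (κ ^ 2 * ∑ i ∈ Finset.Iio j, s i j ^ 2)) := by
  rcases isEmpty_or_nonempty ι with hι | ⟨⟨i0⟩⟩
  · simp
  have hκ0 : 0 ≤ κ := by
    obtain ⟨z⟩ := (P i0).nonempty_of_neZero
    exact (abs_nonneg _).trans (hlκ i0 z)
  set w : ∀ i, Ω i → ℝ := fun i z => l i z - 1 with hw
  have hwm : ∀ i, Measurable (w i) := fun i => (hl i).sub_const 1
  have hli : ∀ i, Integrable (l i) (P i) := fun i => by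
    refine Integrable.of_bound (hl i).aestronglyMeasurable (κ + 1) (.of_forall fun z => ?_)
    have := abs_add_le (l i z - 1) 1
    rw [sub_add_cancel, abs_one] at this
    exact this.trans (by linarith [hlκ i z])
  have hw0 : ∀ i, ∫ z, w i z ∂(P i) = 0 := fun i => by
    rw [integral_sub (hli i) (integrable_const 1), hl1]; simp
  -- Since 1 - l_i l_j = -(w_i + w_j + w_i w_j), the sum over pairs is -∑_j w_j (T_j + R_j): `T`
  -- collects the linear terms and `R` the products. `R j` sees only coordinates before `j`, so
  -- these are martingale differences.
  set R : ι → (∀ j, Ω j) → ℝ := fun j y => ∑ i ∈ Finset.Iio j, s i j * w i (y i) with hR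
  set T : ι → ℝ := fun j => ∑ i, s i j with hT
  set M : ℝ := ∑ i, ∑ j, |s i j| with hM
  have hM0 : 0 ≤ M := Finset.sum_nonneg fun i _ => Finset.sum_nonneg fun j _ => abs_nonneg _
  have hsM : ∀ i j, |s i j| ≤ M := fun i j =>
    (Finset.single_le_sum (f := fun j => |s i j|) (fun j _ => abs_nonneg _)
      (Finset.mem_univ j)).trans
    (Finset.single_le_sum (f := fun i => ∑ j, |s i j|)
      (fun i _ => Finset.sum_nonneg fun j _ => abs_nonneg _) (Finset.mem_univ i))
  have hcol : ∀ j, ∑ i, |s i j| ≤ M := fun j => by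
    rw [hM, Finset.sum_comm]
    exact Finset.single_le_sum (f := fun j => ∑ i, |s i j|)
      (fun i _ => Finset.sum_nonneg fun j _ => abs_nonneg _) (Finset.mem_univ j)
  have hRm : ∀ j, Measurable (R j) := fun j => by fun_prop
  have hRB : ∀ j y, |R j y| ≤ M * κ := fun j y => by
    refine (Finset.abs_sum_le_sum_abs _ _).trans ?_
    refine (Finset.sum_le_univ_sum_of_nonneg fun i => abs_nonneg _).trans ?_
    refine le_trans (Finset.sum_le_sum (g := fun i => |s i j| * κ) fun i _ => ?_) ?_
    · rw [abs_mul]; exact mul_le_mul_of_nonneg_left (hlκ _ _) (abs_nonneg _)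
    · rw [← Finset.sum_mul]; exact mul_le_mul_of_nonneg_right (hcol j) hκ0
  have hTB : ∀ j, |T j| ≤ M := fun j => (Finset.abs_sum_le_sum_abs _ _).trans (hcol j)
  have hRi : ∀ j k, j ≤ k → ∀ y z, R j (Function.update y k z) = R j y := fun j k hjk y z => by
    refine Finset.sum_congr rfl fun i hi => ?_
    rw [Function.update_of_ne ((Finset.mem_Iio.1 hi).trans_le hjk).ne]
  have hRsq : ∀ j, ∫ y, R j y ^ 2 ∂(Measure.pi P) ≤ κ ^ 2 * ∑ i ∈ Finset.Iio j, s i j ^ 2 := by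
    intro j
    -- The same Pythagoras bound, with deterministic coefficients.
    have h := integral_sq_sum_coord_mul_le P (u := w) (κ := κ) (B := M)
      (F := fun i _ => if i < j then s i j else 0) hwm hlκ hw0 (fun i => measurable_const)
      (fun i y => by split_ifs; exacts [hsM i j, by simpa using hM0]) (fun _ _ _ _ _ => rfl)
    have e : ∀ y : ∀ j, Ω j, ∑ i, w i (y i) * (if i < j then s i j else 0) = R j y := fun y => by
      simp only [mul_ite, mul_zero, ← Finset.sum_filter, hR]
      refine Finset.sum_congr (by ext; simp) fun i _ => mul_comm _ _
    have e2 : ∑ i, (if i < j then s i j else 0) ^ 2 = ∑ i ∈ Finset.Iio j, s i j ^ 2 := by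
      simp only [ite_pow, ne_eq, OfNat.ofNat_ne_zero, not_false_eq_true, zero_pow,
        ← Finset.sum_filter]
      exact Finset.sum_congr (by ext; simp) fun i _ => rfl
    simp only [e, integral_const, probReal_univ, one_smul, e2] at h
    exact h
  have hmain := integral_sq_sum_coord_mul_le P (u := w) (κ := κ) (B := M + M * κ)
    (F := fun j y => T j + R j y) hwm hlκ hw0 (fun i => by fun_prop)
    (fun j y => (abs_add_le _ _).trans (add_le_add (hTB j) (hRB j y)))
    (fun j k hjk y z => by rw [hRi j k hjk])
  have e : ∀ y : ∀ j, Ω j, (∑ j, ∑ i ∈ Finset.Iio j, s i j * (1 - l i (y i) * l j (y j))) ^ 2 =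
      (∑ j, w j (y j) * (T j + R j y)) ^ 2 := fun y => by
    rw [← neg_sq]
    congr 1
    have h1 := sum_pairs_symm hs hs0 (fun i => w i (y i))
    simp only [mul_add (w _ _), Finset.sum_add_distrib (f := fun j => w j (y j) * T j)]
    rw [← h1, ← Finset.sum_add_distrib, ← Finset.sum_neg_distrib]
    refine Finset.sum_congr rfl fun j _ => ?_
    rw [hR, Finset.mul_sum, ← Finset.sum_add_distrib, ← Finset.sum_neg_distrib]
    refine Finset.sum_congr rfl fun i _ => ?_
    simp only [hw]; ring
  simp only [e]
  refine hmain.trans (mul_le_mul_of_nonneg_left (Finset.sum_le_sum fun j _ => ?_) (sq_nonneg κ))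
  have hRi2 : Integrable (fun y => R j y ^ 2) (Measure.pi P) := by
    refine Integrable.of_bound (by fun_prop) ((M * κ) ^ 2) (.of_forall fun y => ?_)
    rw [Real.norm_of_nonneg (sq_nonneg _), ← sq_abs]
    gcongr
    exact hRB j y
  have h3 : ∫ y, (T j + R j y) ^ 2 ∂(Measure.pi P) ≤
      ∫ y, (2 * T j ^ 2 + 2 * R j y ^ 2) ∂(Measure.pi P) := by
    refine integral_mono_of_nonneg (.of_forall fun y => sq_nonneg _)
      ((integrable_const _).add (hRi2.const_mul 2)) (.of_forall fun y => ?_)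
    simp only
    nlinarith [sq_nonneg (T j - R j y)]
  rw [integral_add (integrable_const _) (hRi2.const_mul 2), integral_const_mul 2 (fun y => R j y ^ 2),
    integral_const, probReal_univ, one_smul] at h3
  have hTj : ∑ i, s i j = T j := rfl
  rw [hTj]
  linarith [hRsq j]

end Orthogonality

/-! ### Likelihood and score of the binomial random graph -/

section RandomGraph

open scoped Classical

variable {V : Type*}

/-- The contribution of the pair `i, j` to the likelihood of `G` under the binomial distribution
with parameter `t`. -/
noncomputable def edgeWeight (t : ℝ) (G : SimpleGraph V) (i j : V) : ℝ :=
  if G.Adj i j then t else 1 - t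

/-- The contribution of the pair `i, j` to the logarithmic derivative of the likelihood of `G`
under the binomial distribution with parameter `t`. -/
noncomputable def edgeScore (t : ℝ) (G : SimpleGraph V) (i j : V) : ℝ :=
  if i = j then 0 else if G.Adj i j then 1 / t else -(1 / (1 - t))

theorem edgeScore_comm (t : ℝ) (G : SimpleGraph V) (i j : V) :
    edgeScore t G i j = edgeScore t G j i := by
  simp only [edgeScore, G.adj_comm i j, eq_comm (a := i)]

theorem edgeScore_self (t : ℝ) (G : SimpleGraph V) (i : V) : edgeScore t G i i = 0 := by
  simp [edgeScore]

theorem edgeScore_congr (t : ℝ) {G H : SimpleGraph V} {i j : V} (h : G.Adj i j ↔ H.Adj i j) :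
    edgeScore t G i j = edgeScore t H i j := by
  by_cases hH : H.Adj i j <;> simp [edgeScore, h, hH]

theorem edgeWeight_congr (t : ℝ) {G H : SimpleGraph V} {i j : V} (h : G.Adj i j ↔ H.Adj i j) :
    edgeWeight t G i j = edgeWeight t H i j := by
  by_cases hH : H.Adj i j <;> simp [edgeWeight, h, hH]

theorem abs_edgeScore_le {t : ℝ} (h1 : 1 / 4 ≤ t) (h2 : t ≤ 3 / 4) (G : SimpleGraph V) (i j : V) :
    |edgeScore t G i j| ≤ 4 := by
  unfold edgeScore
  split_ifs
  · simp
  · rw [abs_of_nonneg (by positivity), div_le_iff₀ (by linarith)]; linarith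
  · have : 0 < 1 - t := by linarith
    rw [abs_neg, abs_of_nonneg (by positivity), div_le_iff₀ this]; linarith

/-- Toggle the edge between `i` and `j`. -/
noncomputable def toggleEdge (i j : V) (G : SimpleGraph V) : SimpleGraph V := symmDiff G (SimpleGraph.edge i j)

theorem toggleEdge_toggleEdge (i j : V) (G : SimpleGraph V) :
    toggleEdge i j (toggleEdge i j G) = G := by
  simp [toggleEdge]

theorem toggleEdge_adj_of_ne {i j a b : V} (h : s(a, b) ≠ s(i, j)) (G : SimpleGraph V) :
    (toggleEdge i j G).Adj a b ↔ G.Adj a b := by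
  have : ¬ (SimpleGraph.edge i j).Adj a b := fun h' => h (by
    rw [SimpleGraph.edge_adj] at h'
    rw [Sym2.eq_iff]; exact h'.1)
  simp [toggleEdge, symmDiff, this]

theorem toggleEdge_adj_self {i j : V} (h : i ≠ j) (G : SimpleGraph V) :
    (toggleEdge i j G).Adj i j ↔ ¬ G.Adj i j := by
  have : (SimpleGraph.edge i j).Adj i j := by simp [SimpleGraph.edge_adj, h]
  simp [toggleEdge, symmDiff, this]

variable [Fintype V] [LinearOrder V] [LocallyFiniteOrderBot V]

/-- The likelihood of `G` under the binomial distribution with parameter `t`. -/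
noncomputable def graphWeight (t : ℝ) (G : SimpleGraph V) : ℝ :=
  ∏ j, ∏ i ∈ Finset.Iio j, edgeWeight t G i j

theorem graphWeight_nonneg {t : ℝ} (h1 : 0 ≤ t) (h2 : t ≤ 1) (G : SimpleGraph V) :
    0 ≤ graphWeight t G := by
  refine Finset.prod_nonneg fun j _ => Finset.prod_nonneg fun i _ => ?_
  unfold edgeWeight
  split_ifs <;> linarith

theorem hasDerivAt_graphWeight {t : ℝ} (h1 : 0 < t) (h2 : t < 1) (G : SimpleGraph V) :
    HasDerivAt (fun t => graphWeight t G)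
      (graphWeight t G * ∑ j, ∑ i ∈ Finset.Iio j, edgeScore t G i j) t := by
  have he : ∀ i j, i ≠ j → HasDerivAt (fun t => edgeWeight t G i j)
      (edgeWeight t G i j * edgeScore t G i j) t := fun i j hij => by
    unfold edgeWeight edgeScore
    split_ifs
    · rw [mul_one_div_cancel h1.ne']; exact hasDerivAt_id t
    · rw [mul_neg, mul_one_div_cancel (by linarith)]
      exact (hasDerivAt_id t).const_sub 1
  have hj : ∀ j, HasDerivAt (fun t => ∏ i ∈ Finset.Iio j, edgeWeight t G i j)
      ((∏ i ∈ Finset.Iio j, edgeWeight t G i j) * ∑ i ∈ Finset.Iio j, edgeScore t G i j) t :=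
    fun j => by
      refine (HasDerivAt.fun_finsetProd (u := Finset.Iio j)
        (fun i hi => he i j (Finset.mem_Iio.1 hi).ne)).congr_deriv ?_
      rw [Finset.mul_sum]
      refine Finset.sum_congr rfl fun i hi => ?_
      rw [← Finset.prod_erase_mul _ _ hi, smul_eq_mul]; ring
  unfold graphWeight
  refine (HasDerivAt.fun_finsetProd (u := Finset.univ) (fun j _ => hj j)).congr_deriv ?_
  rw [Finset.mul_sum]
  refine Finset.sum_congr rfl fun i hi => ?_
  rw [← Finset.prod_erase_mul _ _ hi, smul_eq_mul]; ring

/-- The score of a pair averages to zero against any function not depending on that pair. -/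
theorem sum_graphWeight_mul_edgeScore_mul_eq_zero {t : ℝ} (h1 : 0 < t) (h2 : t < 1) {i j : V}
    (hij : i ≠ j) {F : SimpleGraph V → ℝ} (hF : ∀ G, F (toggleEdge i j G) = F G) :
    ∑ G, graphWeight t G * (edgeScore t G i j * F G) = 0 := by
  wlog hlt : i < j generalizing i j
  · have hji : ∀ G : SimpleGraph V, toggleEdge j i G = toggleEdge i j G := fun G => by
      rw [toggleEdge, SimpleGraph.edge_comm, toggleEdge]
    simp only [edgeScore_comm t _ i j]
    exact this hij.symm (fun G => by rw [hji, hF]) (lt_of_le_of_ne (not_lt.1 hlt) hij.symm)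
  have hw : ∀ G : SimpleGraph V, graphWeight t G =
      edgeWeight t G i j * ∏ e ∈ (Finset.univ.sigma fun j : V => Finset.Iio j).erase ⟨j, i⟩,
        edgeWeight t G e.2 e.1 := fun G => by
    rw [graphWeight, Finset.prod_sigma', Finset.mul_prod_erase _
      (fun e : (_ : V) × V => edgeWeight t G e.2 e.1) (a := ⟨j, i⟩) (by simpa using hlt)]
  -- Toggling the edge pairs up the graphs. Weight times score of the pair is 1 if the edge is
  -- present and -1 if absent, while all other factors agree, so paired terms cancel.
  refine Finset.sum_involution (fun G _ => toggleEdge i j G) (fun G _ => ?_) (fun G _ _ h => ?_)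
    (fun _ _ => Finset.mem_univ _) (fun G _ => toggleEdge_toggleEdge i j G)
  · rw [hF, hw, hw (toggleEdge i j G)]
    have hrest : ∏ e ∈ (Finset.univ.sigma fun j : V => Finset.Iio j).erase ⟨j, i⟩,
        edgeWeight t (toggleEdge i j G) e.2 e.1 =
        ∏ e ∈ (Finset.univ.sigma fun j : V => Finset.Iio j).erase ⟨j, i⟩,
        edgeWeight t G e.2 e.1 := by
      refine Finset.prod_congr rfl fun e he => ?_
      obtain ⟨a, b⟩ := e
      simp only [Finset.mem_erase, Finset.mem_sigma, Finset.mem_univ, Finset.mem_Iio,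
        true_and] at he
      have : s(b, a) ≠ s(i, j) := fun h => by
        rcases Sym2.eq_iff.1 h with ⟨h3, h4⟩ | ⟨h3, h4⟩
        · subst h3 h4; exact he.1 rfl
        · subst h3 h4; exact lt_asymm hlt he.2
      exact edgeWeight_congr t (toggleEdge_adj_of_ne this G)
    rw [hrest]
    have hz : edgeWeight t G i j * edgeScore t G i j +
        edgeWeight t (toggleEdge i j G) i j * edgeScore t (toggleEdge i j G) i j = 0 := by
      have h3 : 1 - t ≠ 0 := by linarith
      by_cases hG : G.Adj i j <;>
        simp [edgeWeight, edgeScore, toggleEdge_adj_self hij, hG, hij, h1.ne', h3]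
    linear_combination (F G * ∏ e ∈ (Finset.univ.sigma fun j : V => Finset.Iio j).erase ⟨j, i⟩,
        edgeWeight t G e.2 e.1) * hz
  · have := toggleEdge_adj_self hij G
    rw [h] at this
    exact (iff_not_self this).elim

/-- The second moment of the score of the star of a node. -/
theorem sum_graphWeight_mul_sq_sum_edgeScore_le {t : ℝ} (h1 : 1 / 4 ≤ t) (h2 : t ≤ 3 / 4)
    (hsum : ∑ G : SimpleGraph V, graphWeight t G = 1) (j : V) :
    ∑ G : SimpleGraph V, graphWeight t G * (∑ i, edgeScore t G i j) ^ 2 ≤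
      16 * Fintype.card V := by
  -- Toggling `ij` leaves the score of `kj` unchanged, so distinct edges of the star are orthogonal
  -- and only the squares, each at most 16, survive.
  have hoff : ∀ i k, i ≠ k →
      ∑ G : SimpleGraph V, graphWeight t G * (edgeScore t G i j * edgeScore t G k j) = 0 := by
    intro i k hik
    by_cases hij : i = j
    · subst hij; simp [edgeScore_self]
    · refine sum_graphWeight_mul_edgeScore_mul_eq_zero (by linarith) (by linarith) hij fun G => ?_
      have : s(k, j) ≠ s(i, j) := fun h => by
        rcases Sym2.eq_iff.1 h with ⟨h3, h4⟩ | ⟨h3, h4⟩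
        · exact hik h3.symm
        · exact hij h4.symm
      exact edgeScore_congr t (toggleEdge_adj_of_ne this G)
  have hexp : ∑ G : SimpleGraph V, graphWeight t G * (∑ i, edgeScore t G i j) ^ 2 =
      ∑ i, ∑ k, ∑ G : SimpleGraph V, graphWeight t G * (edgeScore t G i j * edgeScore t G k j) := by
    have : ∀ G : SimpleGraph V, graphWeight t G * (∑ i, edgeScore t G i j) ^ 2 =
        ∑ i, ∑ k, graphWeight t G * (edgeScore t G i j * edgeScore t G k j) := fun G => by
      rw [sq, Finset.sum_mul_sum]; simp only [Finset.mul_sum]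
    simp only [this]
    rw [Finset.sum_comm]
    exact Finset.sum_congr rfl fun i _ => Finset.sum_comm
  rw [hexp]
  have : ∀ i, ∑ k, ∑ G : SimpleGraph V, graphWeight t G * (edgeScore t G i j * edgeScore t G k j)
      ≤ 16 := fun i => by
    rw [Finset.sum_eq_single i (fun k _ hk => hoff i k hk.symm) (by simp)]
    calc _ ≤ ∑ G : SimpleGraph V, graphWeight t G * 16 := by
          refine Finset.sum_le_sum fun G _ => mul_le_mul_of_nonneg_left ?_
            (graphWeight_nonneg (by linarith) (by linarith) G)
          have := abs_le.1 (abs_edgeScore_le h1 h2 G i j)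
          nlinarith
      _ = 16 := by rw [← Finset.sum_mul, hsum, one_mul]
  refine (Finset.sum_le_sum fun i _ => this i).trans_eq ?_
  simp [mul_comm]

theorem card_pairs_adj (G : SimpleGraph V) :
    ((Finset.univ.sigma fun j : V => Finset.Iio j).filter fun e => G.Adj e.2 e.1).card =
      G.edgeSet.ncard := by
  rw [← Set.ncard_coe_finset]
  refine Set.ncard_congr (fun e _ => s(e.2, e.1)) ?_ ?_ ?_
  · rintro ⟨j, i⟩ h
    simp only [Finset.coe_filter, Set.mem_ofPred_eq] at h
    exact h.2
  · rintro ⟨j, i⟩ ⟨l, k⟩ h h' heq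
    simp only [Finset.coe_filter, Set.mem_ofPred_eq, Finset.mem_sigma, Finset.mem_univ,
      Finset.mem_Iio, true_and] at h h'
    rcases Sym2.eq_iff.1 heq with ⟨h3, h4⟩ | ⟨h3, h4⟩
    · simp only at h3 h4; subst h3 h4; rfl
    · simp only at h3 h4; subst h3 h4; exact (lt_asymm h.1 h'.1).elim
  · intro e
    induction e using Sym2.ind with
    | _ a b =>
      intro h
      rw [SimpleGraph.mem_edgeSet] at h
      rcases lt_or_gt_of_ne h.ne with hab | hab
      · exact ⟨⟨b, a⟩, by simpa using ⟨hab, h⟩, rfl⟩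
      · exact ⟨⟨a, b⟩, by simpa using ⟨hab, h.symm⟩, Sym2.eq_swap⟩

theorem card_pairs :
    (Finset.univ.sigma fun j : V => Finset.Iio j).card = (Fintype.card V).choose 2 := by
  have h := card_pairs_adj (⊤ : SimpleGraph V)
  rw [← SimpleGraph.coe_edgeFinset, Set.ncard_coe_finset,
    SimpleGraph.card_edgeFinset_top_eq_card_choose_two] at h
  rw [← h]
  congr 1
  ext ⟨j, i⟩
  simpa using fun h : i < j => h.ne

/-- Each edge has exactly one increasing orientation, so the product over `i < j` is governed by the
edge count; this identifies the weight with the mass of a singleton under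
`SimpleGraph.binomialRandom`. -/
theorem graphWeight_eq (t : ℝ) (G : SimpleGraph V) :
    graphWeight t G =
      t ^ G.edgeSet.ncard * (1 - t) ^ ((Fintype.card V).choose 2 - G.edgeSet.ncard) := by
  unfold graphWeight edgeWeight
  rw [Finset.prod_sigma' Finset.univ (fun j => Finset.Iio j)
      (fun j i => if G.Adj i j then t else 1 - t), Finset.prod_ite, Finset.prod_const,
    Finset.prod_const, card_pairs_adj, ← card_pairs, ← card_pairs_adj G]
  congr 2
  rw [← Finset.card_filter_add_card_filter_not
    (s := Finset.univ.sigma fun j : V => Finset.Iio j) (fun e => G.Adj e.2 e.1),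
    Nat.add_sub_cancel_left]

theorem binomialRandom_real_singleton (p : unitInterval) (G : SimpleGraph V) :
    (SimpleGraph.binomialRandom V p).real {G} = graphWeight p G := by
  rw [measureReal_def, SimpleGraph.binomialRandom_singleton]
  simp [graphWeight_eq]

instance measurableSingletonClass_simpleGraph : MeasurableSingletonClass (SimpleGraph V) := by
  refine ⟨fun G => ?_⟩
  have : ({G} : Set (SimpleGraph V)) = SimpleGraph.edgeSet ⁻¹' {G.edgeSet} := by
    ext H; simp
  rw [this]
  exact SimpleGraph.measurable_edgeSet (measurableSet_singleton _)

theorem sum_graphWeight {t : ℝ} (h1 : 0 ≤ t) (h2 : t ≤ 1) :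
    ∑ G : SimpleGraph V, graphWeight t G = 1 := by
  have h := sum_measureReal_singleton (μ := SimpleGraph.binomialRandom V ⟨t, h1, h2⟩) Finset.univ
  simp only [binomialRandom_real_singleton] at h
  rw [h]
  simp

end RandomGraph
-- Decorrelating edge scores from private reports
section LocalRandomizers

variable {ι : Type*} [DecidableEq ι] {Ω : ι → Type*} [∀ i, MeasurableSpace (Ω i)]

/-- The edge `ij` is visible only to `i` and `j`, whose inputs are both overwritten. Hence
expectations under this hybrid law are uncorrelated with the score of `ij`. -/
theorem pi_update_update_toggleEdge (K : ∀ i, Set ι → Measure (Ω i)) (i j : ι)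
    (G : SimpleGraph ι) :
    Function.update (Function.update (fun a => K a ((toggleEdge i j G).neighborSet a)) i (K i ∅))
        j (K j ∅) =
      Function.update (Function.update (fun a => K a (G.neighborSet a)) i (K i ∅)) j (K j ∅) := by
  funext a
  by_cases haj : a = j
  · subst haj; simp
  by_cases hai : a = i
  · subst hai; simp [haj]
  simp only [Function.update_of_ne haj, Function.update_of_ne hai]
  congr 1
  ext b
  rw [SimpleGraph.mem_neighborSet, SimpleGraph.mem_neighborSet, toggleEdge_adj_of_ne]
  intro h
  rcases Sym2.eq_iff.1 h with ⟨h, -⟩ | ⟨h, -⟩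
  exacts [hai h, haj h]

/-- Reweighting two coordinates by near densities almost amounts to changing both factors. -/
theorem abs_integral_mul_two_densities_sub_le [Fintype ι] (P : ∀ i, Measure (Ω i))
    [∀ i, IsProbabilityMeasure (P i)] {i j : ι} (hij : i ≠ j)
    (Q : ∀ i, Measure (Ω i)) [∀ i, IsProbabilityMeasure (Q i)]
    {l : ∀ i, Ω i → ℝ} {η : ℝ} (hl : ∀ i, Measurable (l i)) (hl0 : ∀ i z, 0 ≤ l i z)
    (hl2 : ∀ i z, l i z ≤ 2)
    (hlQ : ∀ i, ∀ g : Ω i → ℝ, Measurable g → (∀ y, 0 ≤ g y) → (∀ y, g y ≤ 1) →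
        |∫ y, g y * l i y ∂(P i) - ∫ y, g y ∂(Q i)| ≤ η)
    {g : (∀ j, Ω j) → ℝ} (hg : Measurable g) (hg0 : ∀ y, 0 ≤ g y) (hg1 : ∀ y, g y ≤ 1) :
    |∫ y, g y * (l i (y i) * l j (y j)) ∂(Measure.pi P) -
      ∫ y, g y ∂(Measure.pi (Function.update (Function.update P i (Q i)) j (Q j)))| ≤ 3 * η := by
  have hla : ∀ i z, |l i z| ≤ 2 := fun i z => by rw [abs_of_nonneg (hl0 i z)]; exact hl2 i z
  -- The test function still carries `l j ≤ 2`, so this replacement costs `2 * η`; the next one, on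
  -- `g ≤ 1`, costs `η`.
  have h1 := abs_integral_mul_density_sub_le P i (Q i) (hl i) (hla i) (hlQ i)
    (f := fun y => g y * l j (y j)) (B := 2) (by fun_prop)
    (fun y => mul_nonneg (hg0 y) (hl0 _ _))
    (fun y => (mul_le_of_le_one_left (hl0 _ _) (hg1 y)).trans (hl2 _ _)) two_pos
  have h2 := abs_integral_mul_density_sub_le (Function.update P i (Q i)) j (Q j) (hl j) (hla j)
    (η := η) (by rw [Function.update_of_ne hij.symm]; exact hlQ j) hg hg0 hg1 one_pos
  have h3 : ∫ y, g y * (l i (y i) * l j (y j)) ∂(Measure.pi P) =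
      ∫ y, g y * l j (y j) * l i (y i) ∂(Measure.pi P) := by
    congr 1; ext y; ring
  rw [h3]
  have := abs_sub_le (∫ y, g y * l j (y j) * l i (y i) ∂(Measure.pi P))
    (∫ y, g y * l j (y j) ∂(Measure.pi (Function.update P i (Q i))))
    (∫ y, g y ∂(Measure.pi (Function.update (Function.update P i (Q i)) j (Q j))))
  linarith

/-- For locally private randomizers on independent coins, the score of the binomial random graph
is almost uncorrelated with every bounded function of the reports. -/
theorem abs_sum_graphWeight_mul_score_le {ι : Type*} [Fintype ι] [LinearOrder ι]
    [LocallyFiniteOrderBot ι] [Nonempty ι] {Ω : ι → Type*} [∀ i, MeasurableSpace (Ω i)] {ε δ t : ℝ} (hε : 0 < ε) (hε4 : ε ≤ 1 / 4)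
    (hδ : 0 ≤ δ) (h1 : 1 / 4 ≤ t) (h2 : t ≤ 3 / 4) (K : ∀ i, Set ι → Measure (Ω i))
    [∀ i N, IsProbabilityMeasure (K i N)]
    (hK : ∀ (G : SimpleGraph ι) i, Indistinguishable ε δ (K i (G.neighborSet i)) (K i ∅))
    {g : (∀ j, Ω j) → ℝ} (hg : Measurable g) (hg0 : ∀ y, 0 ≤ g y) (hg1 : ∀ y, g y ≤ 1) :
    |∑ G : SimpleGraph ι, graphWeight t G * (∑ j, ∑ i ∈ Finset.Iio j, edgeScore t G i j) *
      ∫ y, g y ∂(Measure.pi fun i => K i (G.neighborSet i))| ≤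
      32 * ε * Fintype.card ι + 24 * δ * (Fintype.card ι : ℝ) ^ 2 := by
  set m : ℝ := ((Fintype.card ι : ℕ) : ℝ) with hm
  have hm0 : 0 < m := by rw [hm]; exact_mod_cast Fintype.card_pos
  -- From |e^x - 1| ≤ 2|x| at x = ±2ε.
  set κ : ℝ := 4 * ε with hκ
  have hκ0 : 0 < κ := by positivity
  have hκ1 : κ ≤ 1 := by rw [hκ]; linarith
  choose l hlm hlb hl1 hlQ using fun (G : SimpleGraph ι) i => (hK G i).exists_density hε.le hδ
  have hlκ : ∀ G i z, |l G i z - 1| ≤ κ := fun G i z => by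
    have e1 := (abs_le.1 (Real.abs_exp_sub_one_le (x := 2 * ε)
      (by rw [abs_of_pos (by linarith)]; linarith))).2
    have e2 := (abs_le.1 (Real.abs_exp_sub_one_le (x := -(2 * ε))
      (by rw [abs_neg, abs_of_pos (by linarith)]; linarith))).1
    rw [abs_of_pos (by linarith)] at e1
    rw [abs_neg, abs_of_pos (by linarith)] at e2
    rw [abs_le]
    constructor <;> linarith [(hlb G i z).1, (hlb G i z).2]
  have hl0 : ∀ G i z, 0 ≤ l G i z := fun G i z => by linarith [(abs_le.1 (hlκ G i z)).1]
  have hl2 : ∀ G i z, l G i z ≤ 2 := fun G i z => by linarith [(abs_le.1 (hlκ G i z)).2]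
  set μ : SimpleGraph ι → Measure (∀ j, Ω j) :=
    fun G => Measure.pi fun i => K i (G.neighborSet i) with hμ
  set k : ι → ι → SimpleGraph ι → ℝ := fun i j G => ∫ y, g y ∂(Measure.pi (Function.update
    (Function.update (fun a => K a (G.neighborSet a)) i (K i ∅)) j (K j ∅))) with hk
  set s : SimpleGraph ι → ι → ι → ℝ := fun G => edgeScore t G with hs
  set X : SimpleGraph ι → (∀ j, Ω j) → ℝ := fun G y =>
    ∑ j, ∑ i ∈ Finset.Iio j, s G i j * (1 - l G i (y i) * l G j (y j)) with hX
  set D : SimpleGraph ι → ι → ι → ℝ := fun G i j =>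
    ∫ y, g y * (l G i (y i) * l G j (y j)) ∂(μ G) - k i j G with hD
  have hw0 : ∀ G : SimpleGraph ι, 0 ≤ graphWeight t G :=
    graphWeight_nonneg (by linarith) (by linarith)
  have hwsum : ∑ G : SimpleGraph ι, graphWeight t G = 1 :=
    sum_graphWeight (by linarith) (by linarith)
  have hs4 : ∀ G i j, |s G i j| ≤ 4 := abs_edgeScore_le h1 h2
  have hDb : ∀ G i j, i ≠ j → |D G i j| ≤ 6 * δ := fun G i j hij => by
    have := abs_integral_mul_two_densities_sub_le (fun a => K a (G.neighborSet a)) hij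
      (fun a => K a ∅) (hlm G) (hl0 G) (hl2 G) (hlQ G) hg hg0 hg1
    refine this.trans_eq (by ring)
  have hk0 : ∀ j, ∀ i ∈ Finset.Iio j, ∑ G, graphWeight t G * (s G i j * k i j G) = 0 :=
    fun j i hi => sum_graphWeight_mul_edgeScore_mul_eq_zero (by linarith) (by linarith)
      (Finset.mem_Iio.1 hi).ne fun G => by simp only [hk, pi_update_update_toggleEdge]
  have hXm : ∀ G, Measurable (X G) := fun G => by
    have := hlm G
    fun_prop
  have hll : ∀ G i j (y : ∀ a, Ω a), |l G i (y i) * l G j (y j)| ≤ 4 := fun G i j y => by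
    rw [abs_of_nonneg (mul_nonneg (hl0 _ _ _) (hl0 _ _ _))]
    nlinarith [hl0 G i (y i), hl0 G j (y j), hl2 G i (y i), hl2 G j (y j)]
  have hXb : ∀ G y, |X G y| ≤ ∑ j : ι, ∑ i ∈ Finset.Iio j, 4 * 5 := fun G y => by
    refine (Finset.abs_sum_le_sum_abs _ _).trans (Finset.sum_le_sum fun j _ =>
      (Finset.abs_sum_le_sum_abs _ _).trans (Finset.sum_le_sum fun i _ => ?_))
    rw [abs_mul]
    refine mul_le_mul (hs4 _ _ _) ?_ (abs_nonneg _) (by norm_num)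
    refine (abs_sub _ _).trans ?_
    rw [abs_one]; linarith [hll G i j y]
  have hX2i : ∀ G, Integrable (fun y => X G y ^ 2) (μ G) := fun G =>
    Integrable.of_bound ((hXm G).pow_const 2).aestronglyMeasurable _ (.of_forall fun y => by
      rw [norm_pow]; exact pow_le_pow_left₀ (norm_nonneg _) (hXb G y) 2)
  have hgb : ∀ y, ‖g y‖ ≤ 1 := fun y => by rw [Real.norm_of_nonneg (hg0 y)]; exact hg1 y
  have hgi : ∀ G, Integrable g (μ G) := fun G =>
    Integrable.of_bound hg.aestronglyMeasurable 1 (.of_forall hgb)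
  have hglli : ∀ G i j, Integrable (fun y => g y * (l G i (y i) * l G j (y j))) (μ G) :=
    fun G i j => by
      have := hlm G
      refine Integrable.of_bound (C := 1 * 4) (by fun_prop) (.of_forall fun y => ?_)
      rw [norm_mul]
      exact mul_le_mul (hgb y) (hll G i j y) (norm_nonneg _) zero_le_one
  -- Three parts: the reweighting effect `X`, the near-density error `D`, and the hybrid term `k`,
  -- which vanishes on averaging over `G`.
  have hsplit : ∀ G, (∑ j, ∑ i ∈ Finset.Iio j, s G i j) * ∫ y, g y ∂(μ G) =
      ∫ y, g y * X G y ∂(μ G) + ∑ j, ∑ i ∈ Finset.Iio j, s G i j * D G i j +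
        ∑ j, ∑ i ∈ Finset.Iio j, s G i j * k i j G := fun G => by
    have e1 : ∫ y, g y * X G y ∂(μ G) = ∑ j, ∑ i ∈ Finset.Iio j, s G i j *
        (∫ y, g y ∂(μ G) - ∫ y, g y * (l G i (y i) * l G j (y j)) ∂(μ G)) := by
      have e2 : ∀ y, g y * X G y = ∑ j, ∑ i ∈ Finset.Iio j, s G i j *
          (g y - g y * (l G i (y i) * l G j (y j))) := fun y => by
        simp only [hX, Finset.mul_sum]
        exact Finset.sum_congr rfl fun j _ => Finset.sum_congr rfl fun i _ => by ring
      have e3 : ∀ i j, Integrable (fun y => s G i j *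
          (g y - g y * (l G i (y i) * l G j (y j)))) (μ G) := fun i j =>
        ((hgi G).sub (hglli G i j)).const_mul _
      simp only [e2]
      rw [integral_finsetSum _ fun j _ => integrable_finsetSum _ fun i _ => e3 i j]
      refine Finset.sum_congr rfl fun j _ => ?_
      rw [integral_finsetSum _ fun i _ => e3 i j]
      refine Finset.sum_congr rfl fun i _ => ?_
      rw [integral_const_mul, integral_sub (hgi G) (hglli G i j)]
    rw [e1, ← Finset.sum_add_distrib, ← Finset.sum_add_distrib, Finset.sum_mul]
    refine Finset.sum_congr rfl fun j _ => ?_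
    rw [← Finset.sum_add_distrib, ← Finset.sum_add_distrib, Finset.sum_mul]
    refine Finset.sum_congr rfl fun i _ => ?_
    simp only [hD]; ring
  -- AM-GM, |X| ≤ X²/(2M) + M/2, in place of Cauchy–Schwarz: it is linear in X², so it can be
  -- averaged over `G`. The choice M = 8κm is the square root of the second moment bound below.
  have hgX : ∀ G, |∫ y, g y * X G y ∂(μ G)| ≤
      (∫ y, X G y ^ 2 ∂(μ G)) / (2 * (8 * κ * m)) + 8 * κ * m / 2 := fun G => by
    rw [← Real.norm_eq_abs]
    have e : ∫ y, (X G y ^ 2 / (2 * (8 * κ * m)) + 8 * κ * m / 2) ∂(μ G) =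
        (∫ y, X G y ^ 2 ∂(μ G)) / (2 * (8 * κ * m)) + 8 * κ * m / 2 := by
      rw [integral_add ((hX2i G).div_const _) (integrable_const _), integral_div]
      simp [hμ]
    rw [← e]
    refine norm_integral_le_of_norm_le (((hX2i G).div_const _).add (integrable_const _))
      (.of_forall fun y => ?_)
    have hM : 0 < 8 * κ * m := by positivity
    rw [norm_mul]
    refine (mul_le_of_le_one_left (norm_nonneg _) (hgb y)).trans ?_
    rw [Real.norm_eq_abs, div_add_div _ _ (by positivity) two_ne_zero, le_div_iff₀ (by positivity),
      ← sq_abs (X G y)]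
    nlinarith [sq_nonneg (|X G y| - 8 * κ * m)]
  have hX2 : ∑ G, graphWeight t G * ∫ y, X G y ^ 2 ∂(μ G) ≤ 64 * κ ^ 2 * m ^ 2 := by
    have hcol : ∀ G j, ∑ i ∈ Finset.Iio j, s G i j ^ 2 ≤ 16 * m := fun G j => by
      refine (Finset.sum_le_sum (g := fun _ => (16 : ℝ)) fun i _ => ?_).trans ?_
      · rw [← sq_abs]
        nlinarith [abs_nonneg (s G i j), hs4 G i j]
      · rw [Finset.sum_const, nsmul_eq_mul, mul_comm]
        have : ((Finset.Iio j).card : ℝ) ≤ m :=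
          Nat.cast_le.2 (Finset.card_le_univ _)
        linarith
    have hstar : ∀ j, ∑ G, graphWeight t G * (∑ i, s G i j) ^ 2 ≤ 16 * m :=
      sum_graphWeight_mul_sq_sum_edgeScore_le h1 h2 hwsum
    calc ∑ G, graphWeight t G * ∫ y, X G y ^ 2 ∂(μ G)
        ≤ ∑ G, graphWeight t G * (κ ^ 2 * ∑ j, (2 * (∑ i, s G i j) ^ 2 +
            2 * (κ ^ 2 * ∑ i ∈ Finset.Iio j, s G i j ^ 2))) :=
          Finset.sum_le_sum fun G _ => mul_le_mul_of_nonneg_left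
            (integral_sq_sum_pairs_le (fun i => K i (G.neighborSet i)) (hlm G) (hlκ G) (hl1 G)
              (edgeScore_comm t G) (edgeScore_self t G)) (hw0 G)
      _ ≤ ∑ G, graphWeight t G * (κ ^ 2 * ∑ j, (2 * (∑ i, s G i j) ^ 2 + 32 * m)) := by
          refine Finset.sum_le_sum fun G _ => mul_le_mul_of_nonneg_left
            (mul_le_mul_of_nonneg_left (Finset.sum_le_sum fun j _ => ?_) (sq_nonneg κ)) (hw0 G)
          have h3 : κ ^ 2 * ∑ i ∈ Finset.Iio j, s G i j ^ 2 ≤ 1 * (16 * m) :=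
            mul_le_mul (pow_le_one₀ hκ0.le hκ1) (hcol G j)
              (Finset.sum_nonneg fun i _ => sq_nonneg _) zero_le_one
          linarith
      _ = κ ^ 2 * ∑ j, (2 * ∑ G, graphWeight t G * (∑ i, s G i j) ^ 2 +
            32 * m * ∑ G : SimpleGraph ι, graphWeight t G) := by
          simp only [Finset.mul_sum, ← Finset.sum_add_distrib]
          rw [Finset.sum_comm]
          exact Finset.sum_congr rfl fun j _ => Finset.sum_congr rfl fun G _ => by ring
      _ ≤ κ ^ 2 * ∑ _j : ι, 64 * m := by
          refine mul_le_mul_of_nonneg_left (Finset.sum_le_sum fun j _ => ?_) (sq_nonneg κ)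
          rw [hwsum]
          linarith [hstar j]
      _ = 64 * κ ^ 2 * m ^ 2 := by
          rw [Finset.sum_const, nsmul_eq_mul, Finset.card_univ, ← hm]; ring
  have hDsum : ∀ G, |∑ j, ∑ i ∈ Finset.Iio j, s G i j * D G i j| ≤ 24 * δ * m ^ 2 := fun G => by
    calc _ ≤ ∑ _j : ι, ∑ _i : ι, 24 * δ := by
          refine (Finset.abs_sum_le_sum_abs _ _).trans (Finset.sum_le_sum fun j _ =>
            (Finset.abs_sum_le_sum_abs _ _).trans ?_)
          refine (Finset.sum_le_sum (g := fun _ => 24 * δ) fun i hi => ?_).trans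
            (Finset.sum_le_univ_sum_of_nonneg fun i => by positivity)
          rw [abs_mul]
          have := mul_le_mul (hs4 G i j) (hDb G i j (Finset.mem_Iio.1 hi).ne) (abs_nonneg _)
            (by norm_num)
          linarith
      _ = 24 * δ * m ^ 2 := by
          simp only [Finset.sum_const, nsmul_eq_mul, Finset.card_univ, ← hm]; ring
  have hkz : ∑ G, graphWeight t G * ∑ j, ∑ i ∈ Finset.Iio j, s G i j * k i j G = 0 := by
    simp only [Finset.mul_sum]
    rw [Finset.sum_comm]
    refine Finset.sum_eq_zero fun j _ => ?_
    rw [Finset.sum_comm]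
    exact Finset.sum_eq_zero fun i hi => hk0 j i hi
  have htot : ∑ G : SimpleGraph ι, graphWeight t G * (∑ j, ∑ i ∈ Finset.Iio j, s G i j) *
      ∫ y, g y ∂(μ G) = ∑ G, graphWeight t G * (∫ y, g y * X G y ∂(μ G) +
        ∑ j, ∑ i ∈ Finset.Iio j, s G i j * D G i j) := by
    rw [← add_zero (∑ G, graphWeight t G * (_ + _)), ← hkz, ← Finset.sum_add_distrib]
    refine Finset.sum_congr rfl fun G _ => ?_
    rw [mul_assoc, hsplit]; ring
  rw [htot]
  calc _ ≤ ∑ G, graphWeight t G * ((∫ y, X G y ^ 2 ∂(μ G)) / (2 * (8 * κ * m)) +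
        (8 * κ * m / 2 + 24 * δ * m ^ 2)) := by
        refine (Finset.abs_sum_le_sum_abs _ _).trans (Finset.sum_le_sum fun G _ => ?_)
        rw [abs_mul, abs_of_nonneg (hw0 G)]
        refine mul_le_mul_of_nonneg_left ((abs_add_le _ _).trans ?_) (hw0 G)
        linarith [hgX G, hDsum G]
    _ = (∑ G, graphWeight t G * ∫ y, X G y ^ 2 ∂(μ G)) / (2 * (8 * κ * m)) +
        (8 * κ * m / 2 + 24 * δ * m ^ 2) := by
        simp only [mul_add (graphWeight _ _), Finset.sum_add_distrib, ← Finset.sum_mul, hwsum,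
          Finset.sum_div, mul_div_assoc]
        ring
    _ ≤ (64 * κ ^ 2 * m ^ 2) / (2 * (8 * κ * m)) + (8 * κ * m / 2 + 24 * δ * m ^ 2) := by
        gcongr
    _ = 32 * ε * m + 24 * δ * m ^ 2 := by
        rw [show (64 * κ ^ 2 * m ^ 2) / (2 * (8 * κ * m)) = 4 * κ * m by field_simp; ring, hκ]
        ring

end LocalRandomizers

/-! ### From local randomizers to the output law -/

namespace Protocol

variable {n : ℕ} {Z : Type*} [MeasurableSpace Z]

/-- Node privacy makes every local randomizer locally private. -/
theorem IsPrivate.indistinguishable_rand {P : Protocol.{u, v} n Z} {ε δ : ℝ}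
    (hP : P.IsPrivate ε δ) (r : P.Pub) (G : SimpleGraph (Fin n)) (i : Fin n) :
    Indistinguishable ε δ (P.rand i (G.neighborSet i) r) (P.rand i ∅ r) := by
  -- Deleting all edges at `i` gives a node neighbor in which `i` is isolated; privacy is then
  -- tested on events about the report of `i` alone.
  let H : SimpleGraph (Fin n) :=
    { Adj := fun a b => G.Adj a b ∧ a ≠ i ∧ b ≠ i
      symm := ⟨fun a b h => ⟨h.1.symm, h.2.2, h.2.1⟩⟩
      loopless := ⟨fun a h => G.loopless.irrefl a h.1⟩ }
  have hGH : NodeNeighbors G H := ⟨i, fun j k hj hk => by simp [H, hj, hk]⟩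
  have hHi : H.neighborSet i = ∅ := by
    ext b; simp [H]
  intro S hS
  have h := hP r G H hGH ((fun y => y i) ⁻¹' S) (measurable_pi_apply i hS)
  have e : ∀ G' : SimpleGraph (Fin n), P.reports r G' ((fun y => y i) ⁻¹' S) =
      P.rand i (G'.neighborSet i) r S := fun G' =>
    (measurePreserving_eval (fun i => P.rand i (G'.neighborSet i) r) i).measure_preimage
      hS.nullMeasurableSet
  rwa [e, e, hHi] at h

theorem outputLaw_real (P : Protocol.{u, v} n Z) (G : SimpleGraph (Fin n)) {E : Set Z}
    (hE : MeasurableSet E) :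
    (P.outputLaw G).real E = ∫ r, ∫ y, (P.post y).real E ∂(P.reports r G) ∂P.pub := by
  have hm : Measurable fun r => (P.reports r G).bind P.post :=
    (Measure.measurable_bind' P.post.measurable).comp (P.measurable_reports G)
  have hin : ∀ r, (P.reports r G).bind P.post E = ∫⁻ y, P.post y E ∂(P.reports r G) := fun r =>
    Measure.bind_apply hE P.post.measurable.aemeasurable
  have hle : ∀ r, ∫⁻ y, P.post y E ∂(P.reports r G) ≤ 1 := fun r => by
    refine (lintegral_mono fun y => prob_le_one).trans ?_
    simp
  have hin' : ∀ r, ∫ y, (P.post y).real E ∂(P.reports r G) =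
      (∫⁻ y, P.post y E ∂(P.reports r G)).toReal := fun r =>
    integral_toReal (P.post.measurable_coe hE).aemeasurable
      (.of_forall fun y => measure_lt_top _ _)
  simp only [hin']
  rw [integral_toReal, measureReal_def, outputLaw, Measure.bind_apply hE hm.aemeasurable]
  · simp only [hin]
  · simp only [← hin]
    exact ((Measure.measurable_coe hE).comp hm).aemeasurable
  · exact .of_forall fun r => (hle r).trans_lt ENNReal.one_lt_top

theorem integrable_integral_post (P : Protocol.{u, v} n Z) (G : SimpleGraph (Fin n)) {E : Set Z}
    (hE : MeasurableSet E) :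
    Integrable (fun r => ∫ y, (P.post y).real E ∂(P.reports r G)) P.pub := by
  have hm : Measurable fun r => (P.reports r G).bind P.post :=
    (Measure.measurable_bind' P.post.measurable).comp (P.measurable_reports G)
  have e : ∀ r, ∫ y, (P.post y).real E ∂(P.reports r G) =
      ((P.reports r G).bind P.post E).toReal := fun r => by
    rw [Measure.bind_apply hE P.post.measurable.aemeasurable]
    exact integral_toReal (P.post.measurable_coe hE).aemeasurable
      (.of_forall fun y => measure_lt_top _ _)
  refine Integrable.of_bound (C := 1) ?_ (.of_forall fun r => ?_)
  · simp only [e]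
    exact ((Measure.measurable_coe hE).comp hm).ennreal_toReal.aestronglyMeasurable
  · refine (norm_integral_le_of_norm_le_const (C := 1) (.of_forall fun y => ?_)).trans (by simp)
    rw [Real.norm_of_nonneg measureReal_nonneg]
    exact measureReal_le_one

/-- The probability of an event under a private protocol run on a binomial random graph is
Lipschitz in the parameter of the random graph. -/
theorem IsPrivate.abs_sum_graphWeight_sub_le {P : Protocol.{u, v} n Z} {ε δ : ℝ}
    (hP : P.IsPrivate ε δ) (hn : 0 < n) (hε : 0 < ε) (hε4 : ε ≤ 1 / 4) (hδ : 0 ≤ δ) {E : Set Z}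
    (hE : MeasurableSet E) {p q : ℝ} (hp : p ∈ Set.Icc (1 / 4 : ℝ) (3 / 4))
    (hq : q ∈ Set.Icc (1 / 4 : ℝ) (3 / 4)) :
    |∑ G : SimpleGraph (Fin n), graphWeight q G * (P.outputLaw G).real E -
      ∑ G : SimpleGraph (Fin n), graphWeight p G * (P.outputLaw G).real E| ≤
      (32 * ε * n + 24 * δ * (n : ℝ) ^ 2) * |q - p| := by
  have : Nonempty (Fin n) := ⟨⟨0, hn⟩⟩
  rw [← Real.norm_eq_abs, ← Real.norm_eq_abs]
  -- Mean value inequality. The derivative is bounded for each fixed value of the public randomness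
  -- and then averaged.
  refine (convex_Icc (1 / 4 : ℝ) (3 / 4)).norm_image_sub_le_of_norm_hasDerivWithin_le
    (f := fun t => ∑ G : SimpleGraph (Fin n), graphWeight t G * (P.outputLaw G).real E)
    (f' := fun t => ∑ G : SimpleGraph (Fin n), (graphWeight t G *
      ∑ j, ∑ i ∈ Finset.Iio j, edgeScore t G i j) * (P.outputLaw G).real E)
    (fun t ht => HasDerivAt.hasDerivWithinAt ?_) (fun t ht => ?_) hp hq
  · have ht0 : 0 < t := by linarith [ht.1]
    have ht1 : t < 1 := by linarith [ht.2]
    exact HasDerivAt.fun_sum fun G _ => (hasDerivAt_graphWeight ht0 ht1 G).mul_const _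
  · have e : ∑ G : SimpleGraph (Fin n), (graphWeight t G *
        ∑ j, ∑ i ∈ Finset.Iio j, edgeScore t G i j) * (P.outputLaw G).real E =
        ∫ r, ∑ G : SimpleGraph (Fin n), (graphWeight t G *
          ∑ j, ∑ i ∈ Finset.Iio j, edgeScore t G i j) *
            ∫ y, (P.post y).real E ∂(P.reports r G) ∂P.pub := by
      rw [integral_finsetSum _ fun G _ => (P.integrable_integral_post G hE).const_mul _]
      refine Finset.sum_congr rfl fun G _ => ?_
      rw [integral_const_mul, outputLaw_real P G hE]
    rw [e]
    refine (norm_integral_le_of_norm_le_const (.of_forall fun r => ?_)).trans_eq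
      (by rw [probReal_univ, mul_one])
    have h := abs_sum_graphWeight_mul_score_le hε hε4 hδ ht.1 ht.2
      (fun i N => P.rand i N r) (fun G i => hP.indistinguishable_rand r G i)
      (g := fun y => (P.post y).real E) (P.post.measurable_coe hE).ennreal_toReal
      (fun y => measureReal_nonneg) (fun y => measureReal_le_one)
    rw [Fintype.card_fin] at h
    exact h

end Protocol

/-! ### Conclusion by comparing two parameters -/

theorem successProb_toReal {n : ℕ} (A : SimpleGraph (Fin n) → Measure ℝ)
    [∀ G, IsFiniteMeasure (A G)] (p : unitInterval) (α : ℝ) :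
    (successProb A p α).toReal =
      ∑ G : SimpleGraph (Fin n), graphWeight p G * (A G).real {x : ℝ | |x - p| ≤ α} := by
  classical
  rw [successProb, lintegral_fintype, ENNReal.toReal_sum fun G _ => by finiteness]
  refine Finset.sum_congr (by ext; simp) fun G _ => ?_
  rw [ENNReal.toReal_mul, mul_comm, ← binomialRandom_real_singleton]
  rfl

end LNDP

theorem mainTheorem8 :
    ∃ c > (0 : ℝ), ∃ C > (0 : ℝ), ∃ N : ℕ, ∀ n : ℕ, N ≤ n →
      ∀ ε δ : ℝ, 0 < ε → ε ≤ c → 0 ≤ δ → δ ≤ c * ε / (n * Real.log n) →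
      ∀ A : SimpleGraph (Fin n) → Measure ℝ, LNDP.IsLNDP.{u, v} ε δ A →
      ∀ α : ℝ, (∀ p : unitInterval, 2 / 3 ≤ LNDP.successProb A p α) →
        C * min (1 / (n * ε)) 1 ≤ α := by
  -- `N = 3` ensures log n ≥ 1, so that δn ≤ ε/8. `C = 1/400` is half the constant in `β` below: it
  -- gives 2α < β, which makes the success windows around 1/2 and 1/2 + β disjoint.
  refine ⟨1 / 8, by norm_num, 1 / 400, by norm_num, 3, fun n hn ε δ hε hεc hδ hδc A hA α hα => ?_⟩
  obtain ⟨P, hAP, hP⟩ := hA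
  obtain rfl : A = P.outputLaw := funext hAP
  by_contra! hlt
  have hn0 : (0 : ℝ) < n := by exact_mod_cast (by omega : 0 < n)
  have hn3 : (3 : ℝ) ≤ n := by exact_mod_cast hn
  have hlog : 1 ≤ Real.log n := by
    rw [Real.le_log_iff_exp_le hn0]
    linarith [Real.exp_one_lt_d9]
  have hδn : δ * n ≤ ε / 8 := by
    have h1 : δ * (n * Real.log n) ≤ 1 / 8 * ε := (le_div_iff₀ (by positivity)).1 hδc
    have h2 : δ * n ≤ δ * (n * Real.log n) :=
      mul_le_mul_of_nonneg_left (le_mul_of_one_le_right hn0.le hlog) hδ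
    linarith
  set β : ℝ := min (1 / (n * ε)) 1 / 200 with hβ
  have hβ0 : 0 < β := by rw [hβ]; positivity
  have hβ1 : β ≤ 1 / 200 := by rw [hβ]; linarith [min_le_right (1 / (n * ε)) 1]
  have hβ2 : β * (n * ε) ≤ 1 / 200 := by
    have := mul_le_mul_of_nonneg_right (min_le_left (1 / (n * ε)) 1) (by positivity : 0 ≤ n * ε)
    rw [one_div_mul_cancel (by positivity)] at this
    rw [hβ]; linarith
  have hαβ : 2 * α < β := by rw [hβ]; linarith
  set p : unitInterval := ⟨1 / 2, by norm_num, by norm_num⟩ with hp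
  set q : unitInterval := ⟨1 / 2 + β, by linarith, by linarith⟩ with hq
  have hpv : (p : ℝ) = 1 / 2 := rfl
  have hqv : (q : ℝ) = 1 / 2 + β := rfl
  set E : ℝ → Set ℝ := fun t => {x : ℝ | |x - t| ≤ α} with hE
  have hEm : ∀ t, MeasurableSet (E t) := fun t =>
    measurableSet_le (by fun_prop) measurable_const
  have hsucc : ∀ t : unitInterval, 2 / 3 ≤
      ∑ G : SimpleGraph (Fin n), LNDP.graphWeight t G * (P.outputLaw G).real (E t) := fun t => by
    rw [← LNDP.successProb_toReal]
    have hfin : LNDP.successProb P.outputLaw t α ≠ ⊤ := by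
      refine ne_top_of_le_ne_top ENNReal.one_ne_top ?_
      refine (lintegral_mono fun G => prob_le_one).trans ?_
      simp
    have := ENNReal.toReal_mono hfin (hα t)
    simpa using this
  have hdisj : Disjoint (E p) (E q) := by
    rw [Set.disjoint_left]
    intro x h1 h2
    have h3 : x - p ≤ α := (abs_le.1 (show |x - p| ≤ α from h1)).2
    have h4 : -α ≤ x - q := (abs_le.1 (show |x - q| ≤ α from h2)).1
    rw [hpv] at h3
    rw [hqv] at h4
    linarith
  have hq1 : ∑ G : SimpleGraph (Fin n), LNDP.graphWeight q G * (P.outputLaw G).real (E p) +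
      ∑ G : SimpleGraph (Fin n), LNDP.graphWeight q G * (P.outputLaw G).real (E q) ≤ 1 := by
    rw [← Finset.sum_add_distrib, ← LNDP.sum_graphWeight (V := Fin n) q.2.1 q.2.2]
    refine Finset.sum_le_sum fun G _ => ?_
    rw [← mul_add, ← measureReal_union hdisj (hEm q)]
    exact mul_le_of_le_one_right (LNDP.graphWeight_nonneg q.2.1 q.2.2 G) measureReal_le_one
  have hlip := hP.abs_sum_graphWeight_sub_le (by omega) hε (by linarith) hδ (hEm p)
    (p := p) (q := q) ⟨by rw [hpv]; norm_num, by rw [hpv]; norm_num⟩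
    ⟨by rw [hqv]; linarith, by rw [hqv]; linarith⟩
  -- As 24δn² ≤ 3εn, the Lipschitz constant is at most 35εn, and βnε ≤ 1/200. The resulting 35/200
  -- is below 1/3, yet the window of `p` has probability at least 2/3 under `p` and at most 1/3
  -- under `q`.
  have hL : (32 * ε * n + 24 * δ * (n : ℝ) ^ 2) * |(q : ℝ) - p| ≤ 35 / 200 := by
    rw [hpv, hqv, add_sub_cancel_left, abs_of_pos hβ0]
    have h1 : δ * n * (n * β) ≤ ε / 8 * (n * β) :=
      mul_le_mul_of_nonneg_right hδn (by positivity)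
    nlinarith
  have h1 := (abs_le.1 (hlip.trans hL)).1
  have h2 := hsucc p
  have h3 := hsucc q
  linarith
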